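/- For two integers $p\ge q\ge 1$, a family of sets has the $(p,q)$ property if among any $p$ distinct members of the family some $q$ have a nonempty intersection. The piercing number of a family is the least $k$ such that the family can be split into $k$ or fewer subfamilies, each having a nonempty intersection ($\infty$ if there is no such finite $k$). Let $M(p,q;d)$ denote the supremum of the piercing numbers of all families of nonempty compact convex sets in $\mathbb{R}^d$ with the $(p,q)$ property. Theorem 1.1. For all integers $d\ge 0$ and $p\ge q\ge d+1$ there is a finite constant $c=c(p,q,d)$ such that $M(p,q;d)\le c$; that is, for every (finite or infinite) family $\mathcal{F}$ of nonempty compact convex sets in $\mathbb{R}^d$ that has the $(p,q)$ property there is a set of at most $c$ points in $\mathbb{R}^d$ that intersects each member of $\mathcal{F}$. -/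

import Mathlib

/-- A family `H` of sets has the `(p, q)` property if among any `p` (distinct) members of the
family some `q` have a nonempty intersection. -/
def HasPQProperty {X : Type*} (p q : ℕ) (H : Set (Set X)) : Prop :=
  ∀ S : Finset (Set X), (S : Set (Set X)) ⊆ H → S.card = p →
    ∃ T : Finset (Set X), T ⊆ S ∧ T.card = q ∧ (⋂₀ (T : Set (Set X))).Nonempty

/-- A family `H` is `k`-pierceable if it can be split into `k` or fewer subfamilies, each having
a nonempty intersection. -/
def IsPierceable {X : Type*} (k : ℕ) (H : Set (Set X)) : Prop :=
  ∃ P : Finset (Set (Set X)), P.card ≤ k ∧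
    (P : Set (Set (Set X))).PairwiseDisjoint id ∧
    ⋃₀ (P : Set (Set (Set X))) = H ∧
    ∀ G ∈ P, (⋂₀ G).Nonempty

/-- The piercing number of `H`: the least `k` such that `H` is `k`-pierceable, and `⊤` if there
is no such `k`. -/
noncomputable def piercingNumber {X : Type*} (H : Set (Set X)) : ℕ∞ :=
  ⨅ (k : ℕ) (_ : IsPierceable k H), (k : ℕ∞)

/-- A family of (nonempty) compact convex sets in `ℝ ^ d`. -/
def IsCompactConvexFamily {d : ℕ} (F : Set (Set (EuclideanSpace ℝ (Fin d)))) : Prop :=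
  ∀ A ∈ F, A.Nonempty ∧ IsCompact A ∧ Convex ℝ A

/-- `M(p, q; d)`: the largest possible piercing number (possibly `⊤`) of a family of compact
convex sets in `ℝ ^ d` with the `(p, q)` property. -/
noncomputable def maxPiercingNumber (p q d : ℕ) : ℕ∞ :=
  ⨆ (F : Set (Set (EuclideanSpace ℝ (Fin d)))) (_ : IsCompactConvexFamily F)
    (_ : HasPQProperty p q F), piercingNumber F

/-!
The proof is the one of Alon and Kleitman. "Random" refers throughout to a finite weight
`w ∈ stdSimplex ℝ ι` and to tuples of independent indices of law `w` (`mass`, `powWeight`).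

* Fractional Helly (`fractional_helly`): if `d + 1` random members of a finite family of closed
  convex sets meet with probability at least `α`, then some point lies in a random member with
  probability at least `α / (d + 1)`. Indeed the point of least norm of the intersection of `d + 1`
  sets is determined by some `d` of them (Helly's theorem for these sets and a ball), so that some
  point determined by `d` members lies in an independent further member often enough.
* By the `(p, q)` property and the pigeonhole principle, among `d * p + 1` members some `d + 1` meet
  (`HasPQProperty.exists_embedding`). Hence `d + 1` random members meet with probability bounded
  below, *for every weight on the family*, and fractional Helly applies to all weights at once.
* Linear programming duality (`exists_weight_of_forall_weight`) turns this into one finitely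
  supported weight on the points for which every member has weight at least a constant `β`.
* Weak ε-nets (`exists_weak_net`): boundedly many points meet all convex sets of weight at least `β`.
  They are chosen greedily, by means of a selection lemma (`exists_le_mass_mem_convexHull`): some
  point lies in the hull of a random `N`-tuple with positive probability. This is fractional Helly
  again, for the hulls of all `N`-tuples; `d + 1` random tuples have intersecting hulls with
  positive probability by a weak form of Tverberg's theorem (`exists_partition_mem_convexHull`).
* Infinite families are reduced to finite ones by Rado's selection principle and compactness
  (`exists_piercing_finset_of_forall_finite`).
-/

/-! ### Weighted events and product weights -/

open Classical in
/-- The total `w`-weight of the indices satisfying `P`. For `w ∈ stdSimplex ℝ ι` this is the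
probability of the event `P`. -/
noncomputable def mass {ι : Type*} [Fintype ι] (w : ι → ℝ) (P : ι → Prop) : ℝ :=
  ∑ i, if P i then w i else 0

/-- The product weight on tuples `κ → ι`: the law of a `κ`-indexed family of independent indices,
each of law `w`. -/
def powWeight {ι : Type*} (κ : Type*) [Fintype κ] (w : ι → ℝ) (t : κ → ι) : ℝ :=
  ∏ k, w (t k)

section Mass

variable {ι κ : Type*} [Fintype ι] [Fintype κ] {w : ι → ℝ}

lemma mass_nonneg (hw : ∀ i, 0 ≤ w i) (P : ι → Prop) : 0 ≤ mass w P := by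
  unfold mass
  exact Finset.sum_nonneg fun i _ => by split_ifs <;> simp [hw]

lemma mass_mono (hw : ∀ i, 0 ≤ w i) {P Q : ι → Prop} (h : ∀ i, P i → Q i) :
    mass w P ≤ mass w Q := by
  unfold mass
  refine Finset.sum_le_sum fun i _ => ?_
  by_cases hP : P i
  · simp [hP, h i hP]
  · simp only [hP, if_false]
    split_ifs <;> simp [hw]

lemma mass_of_forall (hw : w ∈ stdSimplex ℝ ι) {P : ι → Prop} (h : ∀ i, P i) : mass w P = 1 := by
  simp [mass, h, hw.2]

lemma mass_le_one (hw : w ∈ stdSimplex ℝ ι) (P : ι → Prop) : mass w P ≤ 1 :=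
  (mass_mono hw.1 (Q := fun _ => True) fun _ _ => trivial).trans
    (mass_of_forall hw fun _ => trivial).le

lemma mass_exists_le {α : Type*} [Fintype α] (hw : ∀ i, 0 ≤ w i) (P : α → ι → Prop) :
    mass w (fun i => ∃ a, P a i) ≤ ∑ a, mass w (P a) := by
  classical
  unfold mass
  rw [Finset.sum_comm]
  refine Finset.sum_le_sum fun i _ => ?_
  have hnn : ∀ a, 0 ≤ if P a i then w i else 0 := fun a => by split_ifs <;> simp [hw]
  split_ifs with h
  · obtain ⟨a, ha⟩ := h
    calc w i = if P a i then w i else 0 := by simp [ha]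
      _ ≤ _ := Finset.single_le_sum (f := fun a => if P a i then w i else 0)
        (fun a _ => hnn a) (Finset.mem_univ a)
  · exact Finset.sum_nonneg fun a _ => hnn a

lemma mass_add_le (hw : ∀ i, 0 ≤ w i) {P Q R : ι → Prop} (hPQ : ∀ i, P i → ¬ Q i)
    (hP : ∀ i, P i → R i) (hQ : ∀ i, Q i → R i) : mass w P + mass w Q ≤ mass w R := by
  classical
  unfold mass
  rw [← Finset.sum_add_distrib]
  refine Finset.sum_le_sum fun i _ => ?_
  by_cases h : P i
  · simp [h, hPQ i h, hP i h]
  · by_cases h' : Q i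
    · simp [h, h', hQ i h']
    · simp only [h, h', if_false, add_zero]
      split_ifs <;> simp [hw]

lemma exists_le_of_le_sum_mul (hw : w ∈ stdSimplex ℝ ι) {f : ι → ℝ} {c : ℝ}
    (h : c ≤ ∑ i, w i * f i) : ∃ i, c ≤ f i := by
  by_contra! hf
  have h1 : ∑ i, w i * f i ≤ ∑ i, w i * c :=
    Finset.sum_le_sum fun i _ => mul_le_mul_of_nonneg_left (hf i).le (hw.1 i)
  obtain ⟨i, -, hi⟩ : ∃ i ∈ Finset.univ, 0 < w i := by
    by_contra! h0
    have := Finset.sum_nonpos h0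
    rw [hw.2] at this
    linarith
  have h2 : ∑ i, w i * f i < ∑ i, w i * c :=
    Finset.sum_lt_sum (fun i _ => mul_le_mul_of_nonneg_left (hf i).le (hw.1 i))
      ⟨i, Finset.mem_univ i, mul_lt_mul_of_pos_left (hf i) hi⟩
  rw [← Finset.sum_mul, hw.2] at h2
  linarith

lemma powWeight_mem_stdSimplex [DecidableEq κ] (hw : w ∈ stdSimplex ℝ ι) :
    powWeight κ w ∈ stdSimplex ℝ (κ → ι) := by
  refine ⟨fun t => Finset.prod_nonneg fun k _ => hw.1 _, ?_⟩
  have := Finset.prod_univ_sum (fun _ : κ => (Finset.univ : Finset ι)) (fun _ i => w i)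
  simpa [powWeight, hw.2] using this.symm

/-- Marginals of a product weight: the coordinates of a random tuple at the places `e k` form again
a tuple of independent indices. -/
lemma mass_powWeight_comp {κ' : Type*} [Fintype κ'] [DecidableEq κ] [DecidableEq κ']
    (hw : w ∈ stdSimplex ℝ ι) {e : κ → κ'} (he : Function.Injective e) (P : (κ → ι) → Prop) :
    mass (powWeight κ' w) (fun t => P (t ∘ e)) = mass (powWeight κ w) P := by
  classical
  unfold mass
  let E : ((κ' → ι)) ≃ (κ → ι) × ({k // ¬ k ∈ Set.range e} → ι) :=
    (Equiv.piEquivPiSubtypeProd (· ∈ Set.range e) (fun _ => ι)).trans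
      (Equiv.prodCongr ((Equiv.ofInjective e he).arrowCongr (Equiv.refl ι)).symm (Equiv.refl _))
  have hE1 : ∀ t, (E t).1 = t ∘ e := fun t => rfl
  have hE2 : ∀ t, powWeight κ' w t = powWeight κ w (E t).1 * powWeight _ w (E t).2 := by
    intro t
    rw [hE1]
    unfold powWeight
    rw [← Fintype.prod_subtype_mul_prod_subtype (· ∈ Set.range e) (fun k => w (t k))]
    congr 1
    convert ((Equiv.ofInjective e he).prod_comp (fun k => w (t k))).symm
    rfl
  calc _ = ∑ t, (fun s : (κ → ι) × ({k // ¬ k ∈ Set.range e} → ι) =>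
        (if P s.1 then powWeight κ w s.1 else 0) * powWeight _ w s.2) (E t) := by
        refine Finset.sum_congr rfl fun t _ => ?_
        simp only [hE2, hE1]
        split_ifs <;> simp
    _ = ∑ s : (κ → ι) × ({k // ¬ k ∈ Set.range e} → ι),
        (if P s.1 then powWeight κ w s.1 else 0) * powWeight _ w s.2 :=
        Fintype.sum_equiv E _ _ fun _ => rfl
    _ = _ := by
        rw [Fintype.sum_prod_type]
        simp_rw [← Finset.mul_sum, (powWeight_mem_stdSimplex hw).2, mul_one]

/-- If at least one of finitely many events always occurs, then one of them is as likely as the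
average. -/
lemma exists_inv_card_le_mass {α : Type*} [Fintype α] (hw : w ∈ stdSimplex ℝ ι)
    {P : α → ι → Prop} (h : ∀ i, ∃ a, P a i) :
    ∃ a, (Fintype.card α : ℝ)⁻¹ ≤ mass w (P a) := by
  have h1 : 1 ≤ ∑ a, mass w (P a) := by
    rw [← mass_of_forall hw h]
    exact mass_exists_le hw.1 P
  by_contra! h2
  rcases isEmpty_or_nonempty α with hα | hα
  · simp at h1
    linarith
  · have := Finset.sum_lt_sum_of_nonempty (s := Finset.univ) Finset.univ_nonempty
      (fun a _ => h2 a)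
    have h3 : (Fintype.card α : ℝ) ≠ 0 := by simp
    simp [h3] at this
    linarith

end Mass

/-! ### Fractional Helly -/

section FractionalHelly

open Module

variable {E : Type*} [NormedAddCommGroup E] [InnerProductSpace ℝ E]

open Classical in
/-- The point of least norm of a set, if the set has such a point, and `0` otherwise. -/
noncomputable def minNormPoint (K : Set E) : E :=
  if h : ∃ v ∈ K, ∀ u ∈ K, ‖v‖ ≤ ‖u‖ then h.choose else 0

lemma minNormPoint_eq {K : Set E} (hK : Convex ℝ K) {v : E} (hv : v ∈ K)
    (hmin : ∀ u ∈ K, ‖v‖ ≤ ‖u‖) : minNormPoint K = v := by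
  have h : ∃ v ∈ K, ∀ u ∈ K, ‖v‖ ≤ ‖u‖ := ⟨v, hv, hmin⟩
  obtain ⟨hm, hm'⟩ := h.choose_spec
  rw [minNormPoint, dif_pos h]
  set u := h.choose
  by_contra hne
  have h1 := (norm_midpoint_lt_iff (le_antisymm (hm' v hv) (hmin u hm))).2 hne
  have h2 : (1 / 2 : ℝ) • (u + v) ∈ K := by
    rw [smul_add]
    exact hK hm hv (by norm_num) (by norm_num) (by norm_num)
  exact absurd (hm' _ h2) (not_le.2 h1)

variable [FiniteDimensional ℝ E]

/-- The nearest point to the origin of an intersection of `d + 1` closed convex sets is already the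
nearest point of the intersection of some `d` of them. -/
lemma exists_minNormPoint_mem {d : ℕ} (hd : finrank ℝ E = d) {K : Fin (d + 1) → Set E}
    (hconv : ∀ j, Convex ℝ (K j)) (hcl : ∀ j, IsClosed (K j)) (hne : (⋂ j, K j).Nonempty) :
    ∃ j, minNormPoint (⋂ i, K (j.succAbove i)) ∈ K j := by
  obtain ⟨v, hv, hv'⟩ := (isClosed_iInter hcl).exists_infDist_eq_dist hne 0
  have hmin : ∀ u ∈ ⋂ j, K j, ‖v‖ ≤ ‖u‖ := by
    intro u hu
    have := Metric.infDist_le_dist_of_mem (x := (0 : E)) hu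
    rw [hv'] at this
    simpa using this
  rw [Set.mem_iInter] at hv
  suffices ∃ j, ∀ u ∈ ⋂ i, K (Fin.succAbove j i), ‖v‖ ≤ ‖u‖ by
    obtain ⟨j, hj⟩ := this
    refine ⟨j, ?_⟩
    rw [minNormPoint_eq (convex_iInter fun i => hconv _) (Set.mem_iInter.2 fun i => hv _) hj]
    exact hv j
  -- Otherwise Helly's theorem applies to the sets `K j` and the open ball of radius `‖v‖`.
  by_contra! hcon
  let F : Option (Fin (d + 1)) → Set E := fun o => o.elim (Metric.ball 0 ‖v‖) K
  have hF : (⋂ i ∈ (Finset.univ : Finset (Option (Fin (d + 1)))), F i).Nonempty := by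
    refine Convex.helly_theorem (𝕜 := ℝ) (by simp [hd]) ?_ ?_
    · rintro (_ | j) -
      · exact convex_ball _ _
      · exact hconv j
    · intro I _ hI
      have : (Iᶜ).card = 1 := by
        rw [Finset.card_compl, hI, hd]
        simp
      obtain ⟨o, ho⟩ := Finset.card_eq_one.1 this
      have hIo : ∀ i ∈ I, i ≠ o := by
        rintro i hi rfl
        have : i ∈ Iᶜ := by simp [ho]
        exact Finset.mem_compl.1 this hi
      rcases o with _ | j
      · refine ⟨v, Set.mem_iInter₂.2 fun i hi => ?_⟩
        rcases i with _ | i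
        · exact absurd rfl (hIo _ hi)
        · exact hv i
      · obtain ⟨u, hu, huv⟩ := hcon j
        rw [Set.mem_iInter] at hu
        refine ⟨u, Set.mem_iInter₂.2 fun i hi => ?_⟩
        rcases i with _ | i
        · simpa [F] using huv
        · have hij : i ≠ j := fun h => hIo _ hi (by rw [h])
          obtain ⟨k, rfl⟩ := Fin.exists_succAbove_eq hij
          exact hu k
  obtain ⟨u, hu⟩ := hF
  simp only [Finset.mem_univ, Set.iInter_true, Set.mem_iInter] at hu
  have h1 : ‖u‖ < ‖v‖ := by simpa [F] using hu none
  exact absurd (hmin u (Set.mem_iInter.2 fun j => hu (some j))) (not_le.2 h1)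

/-- **Fractional Helly theorem**, weighted form: if `d + 1` independent random members of a finite
family of closed convex sets intersect with probability at least `α`, then some point lies in
a random member with probability at least `α / (d + 1)`. -/
theorem fractional_helly {d : ℕ} (hd : finrank ℝ E = d) {ι : Type*} [Fintype ι] {w : ι → ℝ}
    (hw : w ∈ stdSimplex ℝ ι) {K : ι → Set E} (hconv : ∀ i, Convex ℝ (K i))
    (hcl : ∀ i, IsClosed (K i)) {α : ℝ}
    (hα : α ≤ mass (powWeight (Fin (d + 1)) w) fun t => (⋂ j, K (t j)).Nonempty) :
    ∃ x, α / (d + 1) ≤ mass w fun i => x ∈ K i := by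
  classical
  -- The nearest point determined by all coordinates of a tuple but one.
  let v : (Fin d → ι) → E := fun s => minNormPoint (⋂ k, K (s k))
  have hsum : α ≤ ∑ j : Fin (d + 1), mass (powWeight (Fin (d + 1)) w)
      fun t => v (fun k => t (j.succAbove k)) ∈ K (t j) := by
    refine hα.trans (le_trans (mass_mono (powWeight_mem_stdSimplex hw).1 ?_)
      (mass_exists_le (powWeight_mem_stdSimplex hw).1 _))
    intro t ht
    exact exists_minNormPoint_mem hd (fun j => hconv (t j)) (fun j => hcl (t j)) ht
  obtain ⟨j, -, hj⟩ : ∃ j ∈ (Finset.univ : Finset (Fin (d + 1))), α / (d + 1) ≤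
      mass (powWeight (Fin (d + 1)) w) fun t => v (fun k => t (j.succAbove k)) ∈ K (t j) := by
    refine Finset.exists_le_of_sum_le Finset.univ_nonempty ?_
    refine le_trans (le_of_eq ?_) hsum
    simp
    field_simp
  have hfub : (mass (powWeight (Fin (d + 1)) w)
      fun t => v (fun k => t (j.succAbove k)) ∈ K (t j)) =
      ∑ s, powWeight (Fin d) w s * mass w fun i => v s ∈ K i := by
    unfold mass
    rw [← Equiv.sum_comp (Fin.insertNthEquiv (fun _ => ι) j), Fintype.sum_prod_type_right]
    refine Finset.sum_congr rfl fun s _ => ?_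
    rw [Finset.mul_sum]
    refine Finset.sum_congr rfl fun i _ => ?_
    simp [powWeight, Fin.prod_univ_succAbove _ j, mul_comm]
  rw [hfub] at hj
  obtain ⟨s, hs⟩ := exists_le_of_le_sum_mul (powWeight_mem_stdSimplex hw) hj
  exact ⟨v s, hs⟩

end FractionalHelly

/-! ### Partitioning points into groups with a common hull point -/

section Tverberg

open Module

variable {E : Type*} [AddCommGroup E] [Module ℝ E] [FiniteDimensional ℝ E]

/-- A deep point: if `N > (d + 1) * D` then some point stays in the convex hull of `N` given points
after the deletion of any `D` of them. -/
lemma exists_forall_mem_convexHull_of_card_compl_le {d : ℕ} (hd : finrank ℝ E = d) {N D : ℕ}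
    (hN : (d + 1) * D < N) (x : Fin N → E) :
    ∃ z, ∀ S : Finset (Fin N), Sᶜ.card ≤ D → z ∈ convexHull ℝ (x '' S) := by
  have h : (⋂ S ∈ (Finset.univ.filter fun S : Finset (Fin N) => Sᶜ.card ≤ D),
      convexHull ℝ (x '' (S : Set (Fin N)))).Nonempty := by
    refine Convex.helly_theorem' (𝕜 := ℝ) (fun _ _ => convex_convexHull ℝ _) ?_
    intro I hI hcard
    have hlt : (I.biUnion fun S => Sᶜ).card < (Finset.univ : Finset (Fin N)).card := by
      calc (I.biUnion fun S => Sᶜ).card ≤ I.card * D :=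
            Finset.card_biUnion_le_card_mul _ _ _ fun S hS => (Finset.mem_filter.1 (hI hS)).2
        _ ≤ (d + 1) * D := Nat.mul_le_mul_right _ (hd ▸ hcard)
        _ < _ := by simpa using hN
    obtain ⟨k, -, hk⟩ := Finset.exists_mem_notMem_of_card_lt_card hlt
    refine ⟨x k, Set.mem_iInter₂.2 fun S hS => subset_convexHull ℝ _ ⟨k, ?_, rfl⟩⟩
    by_contra hkS
    exact hk (Finset.mem_biUnion.2 ⟨S, hS, Finset.mem_compl.2 hkS⟩)
  obtain ⟨z, hz⟩ := h
  exact ⟨z, fun S hS => Set.mem_iInter₂.1 hz S (by simpa using hS)⟩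

/-- Carathéodory's theorem for indexed points. -/
lemma exists_finset_mem_convexHull_image {d : ℕ} (hd : finrank ℝ E = d) {ι : Type*} (x : ι → E)
    {S : Set ι} {z : E} (hz : z ∈ convexHull ℝ (x '' S)) :
    ∃ T : Finset ι, (T : Set ι) ⊆ S ∧ T.card ≤ d + 1 ∧ z ∈ convexHull ℝ (x '' T) := by
  classical
  rw [convexHull_eq_union] at hz
  simp only [Set.mem_iUnion] at hz
  obtain ⟨t, htS, hind, hzt⟩ := hz
  obtain ⟨T, hTS, hinj, hT⟩ := Finset.exists_subset_injOn_image_eq_of_surjOn S t htS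
  refine ⟨T, hTS, ?_, by rwa [← Finset.coe_image, hT]⟩
  rw [← Finset.card_image_of_injOn hinj, hT, ← hd]
  have := hind.card_le_finrank_succ
  simp only [Fintype.card_coe] at this
  exact this.trans (Nat.succ_le_succ (Submodule.finrank_le _))

/-- A weak form of Tverberg's theorem: sufficiently many points can be split into `d + 1` groups
whose convex hulls have a point in common. -/
theorem exists_partition_mem_convexHull {d : ℕ} (hd : finrank ℝ E = d) {N : ℕ}
    (hN : (d + 1) * ((d + 1) * (d + 1)) < N) (x : Fin N → E) :
    ∃ l : Fin N → Fin (d + 1), ∃ z, ∀ j, z ∈ convexHull ℝ (x '' {k | l k = j}) := by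
  classical
  obtain ⟨z, hz⟩ := exists_forall_mem_convexHull_of_card_compl_le hd hN x
  -- Split off the groups one at a time: each one uses up at most `d + 1` points.
  have key : ∀ r ≤ d + 1, ∃ l : Fin N → ℕ, (∀ j < r, z ∈ convexHull ℝ (x '' {k | l k = j})) ∧
      (Finset.univ.filter fun k => l k < r).card ≤ (d + 1) * r := by
    intro r
    induction r with
    | zero => exact fun _ => ⟨fun _ => 0, by simp, by simp⟩
    | succ r ih =>
      intro hr
      obtain ⟨l, hl, hc⟩ := ih (by omega)
      have hzS := hz (Finset.univ.filter fun k => l k < r)ᶜ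
        (by rw [compl_compl]; exact hc.trans (Nat.mul_le_mul_left _ (by omega)))
      obtain ⟨T, hTS, hTc, hzT⟩ := exists_finset_mem_convexHull_image hd x hzS
      have hT : ∀ k ∈ T, r ≤ l k := fun k hk => by simpa using hTS hk
      refine ⟨fun k => if k ∈ T then r else if l k < r then l k else r + 1, ?_, ?_⟩
      · intro j hj
        rcases Nat.lt_succ_iff_lt_or_eq.1 hj with hj | rfl
        · refine convexHull_mono (Set.image_mono ?_) (hl j hj)
          intro k hk
          have hk' : l k = j := hk
          have : k ∉ T := fun h => by have := hT k h; omega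
          simp [this, hk', hj]
        · refine convexHull_mono (Set.image_mono ?_) hzT
          intro k hk
          have : k ∈ T := hk
          simp [this]
      · calc _ ≤ (T ∪ Finset.univ.filter fun k => l k < r).card := by
              refine Finset.card_le_card fun k hk => ?_
              simp only [Finset.mem_filter, Finset.mem_univ, true_and, Finset.mem_union] at hk ⊢
              split_ifs at hk with h1 h2
              · exact Or.inl h1
              · exact Or.inr h2
              · omega
          _ ≤ (d + 1) + (d + 1) * r := (Finset.card_union_le _ _).trans (add_le_add hTc hc)
          _ = _ := by ring
  obtain ⟨l, hl, -⟩ := key (d + 1) le_rfl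
  refine ⟨fun k => Fin.ofNat (d + 1) (l k), z, fun j => ?_⟩
  refine convexHull_mono (Set.image_mono ?_) (hl j j.2)
  intro k hk
  have hk' : l k = j := hk
  simp [hk']

end Tverberg

/-! ### Selection lemma and weak epsilon-nets -/

section WeakNet

open Module

variable {E : Type*} [NormedAddCommGroup E] [InnerProductSpace ℝ E] [FiniteDimensional ℝ E]

/-- **Selection lemma**: some point lies in the convex hull of a random `N`-tuple with probability
bounded below in terms of the dimension and `N` only. -/
theorem exists_le_mass_mem_convexHull {d : ℕ} (hd : finrank ℝ E = d) {N : ℕ}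
    (hN : (d + 1) * ((d + 1) * (d + 1)) < N) {ι : Type*} [Fintype ι] {w : ι → ℝ}
    (hw : w ∈ stdSimplex ℝ ι) (x : ι → E) :
    ∃ z, ((Fintype.card (Fin N → Fin (d + 1)) : ℝ)⁻¹ / (d + 1)) ≤
      mass (powWeight (Fin N) w) fun t => z ∈ convexHull ℝ (Set.range (x ∘ t)) := by
  classical
  have hW := powWeight_mem_stdSimplex (κ := Fin N) hw
  refine fractional_helly hd hW (fun t => convex_convexHull ℝ _)
    (fun t => (Set.finite_range _).isClosed_convexHull _) ?_
  obtain ⟨l, hl⟩ := exists_inv_card_le_mass hW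
    (P := fun (l : Fin N → Fin (d + 1)) t => ∃ z, ∀ j, z ∈ convexHull ℝ ((x ∘ t) '' {k | l k = j}))
    (fun t => exists_partition_mem_convexHull hd hN (x ∘ t))
  refine hl.trans ?_
  -- The `k`-th point is read off from the `k`-th place of the `l k`-th of `d + 1` random tuples, so
  -- that the points of group `j` all belong to the `j`-th tuple.
  have he : Function.Injective fun k : Fin N => (l k, k) := fun a b h => (Prod.ext_iff.1 h).2
  rw [← mass_powWeight_comp hw he]
  have hcurry : mass (powWeight (Fin (d + 1)) (powWeight (Fin N) w))
      (fun t => (⋂ j, convexHull ℝ (Set.range (x ∘ t j))).Nonempty) =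
      mass (powWeight (Fin (d + 1) × Fin N) w)
      (fun t => (⋂ j, convexHull ℝ (Set.range (x ∘ fun k => t (j, k)))).Nonempty) := by
    unfold mass
    refine (Fintype.sum_equiv (Equiv.curry (Fin (d + 1)) (Fin N) ι) _ _ fun t => ?_).symm
    simp only [powWeight, Fintype.prod_prod_type]
    rfl
  rw [hcurry]
  refine mass_mono (powWeight_mem_stdSimplex hw).1 ?_
  rintro t ⟨z, hz⟩
  refine ⟨z, Set.mem_iInter.2 fun j => convexHull_mono ?_ (hz j)⟩
  rintro _ ⟨k, hk, rfl⟩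
  have hk' : l k = j := hk
  exact ⟨k, by simp [← hk']⟩

/-- The selection lemma inside a set `C` of weight at least `ε`. -/
lemma exists_le_mass_mem_convexHull_of_le_mass {d : ℕ} (hd : finrank ℝ E = d) {N : ℕ}
    (hN : (d + 1) * ((d + 1) * (d + 1)) < N) {ι : Type*} [Fintype ι] {w : ι → ℝ}
    (hw : w ∈ stdSimplex ℝ ι) (x : ι → E) {ε : ℝ} (hε : 0 < ε) {C : Set E}
    (hC : ε ≤ mass w fun i => x i ∈ C) :
    ∃ z, ε ^ N * ((Fintype.card (Fin N → Fin (d + 1)) : ℝ)⁻¹ / (d + 1)) ≤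
      mass (powWeight (Fin N) w) fun t =>
        (∀ k, x (t k) ∈ C) ∧ z ∈ convexHull ℝ (Set.range (x ∘ t)) := by
  classical
  set a := mass w fun i => x i ∈ C with ha
  have ha0 : 0 < a := hε.trans_le hC
  let u : ι → ℝ := fun i => a⁻¹ * if x i ∈ C then w i else 0
  have hu : u ∈ stdSimplex ℝ ι := by
    refine ⟨fun i => mul_nonneg (inv_nonneg.2 ha0.le) (by split_ifs <;> simp [hw.1 i]), ?_⟩
    have : ∑ i, u i = a⁻¹ * a := by
      simp only [u]
      rw [← Finset.mul_sum]
      rfl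
    rw [this, inv_mul_cancel₀ ha0.ne']
  obtain ⟨z, hz⟩ := exists_le_mass_mem_convexHull hd hN hu x
  refine ⟨z, ?_⟩
  have hpow : ∀ t : Fin N → ι, a ^ N * powWeight (Fin N) u t =
      if ∀ k, x (t k) ∈ C then powWeight (Fin N) w t else 0 := by
    intro t
    have h1 : powWeight (Fin N) u t = (a⁻¹) ^ N * ∏ k, if x (t k) ∈ C then w (t k) else 0 := by
      simp only [powWeight, u, Finset.prod_mul_distrib, Finset.prod_const, Finset.card_univ,
        Fintype.card_fin]
    rw [h1, ← mul_assoc, ← mul_pow, mul_inv_cancel₀ ha0.ne', one_pow, one_mul]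
    split_ifs with h
    · exact Finset.prod_congr rfl fun k _ => by simp [h k]
    · push Not at h
      obtain ⟨k, hk⟩ := h
      exact Finset.prod_eq_zero (Finset.mem_univ k) (by simp [hk])
  calc _ ≤ a ^ N * ((Fintype.card (Fin N → Fin (d + 1)) : ℝ)⁻¹ / (d + 1)) := by
        have : ε ^ N ≤ a ^ N := pow_le_pow_left₀ hε.le hC N
        gcongr
    _ ≤ a ^ N * mass (powWeight (Fin N) u) fun t => z ∈ convexHull ℝ (Set.range (x ∘ t)) := by
        gcongr
    _ = _ := by
        unfold mass
        rw [Finset.mul_sum]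
        refine Finset.sum_congr rfl fun t _ => ?_
        rw [mul_ite, mul_zero, hpow]
        split_ifs <;> simp_all

/-- **Weak ε-nets for convex sets**: the number of points needed to meet every convex set of weight
at least `ε` is bounded in terms of `ε` and the dimension only. -/
theorem exists_weak_net (d : ℕ) {ε : ℝ} (hε : 0 < ε) : ∃ c : ℕ, ∀ {E : Type*}
    [NormedAddCommGroup E] [InnerProductSpace ℝ E] [FiniteDimensional ℝ E], finrank ℝ E = d →
    ∀ {ι : Type*} [Fintype ι] {w : ι → ℝ}, w ∈ stdSimplex ℝ ι → ∀ x : ι → E,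
    ∃ Y : Finset E, Y.card ≤ c ∧ ∀ C : Set E, Convex ℝ C → (ε ≤ mass w fun i => x i ∈ C) →
      ∃ y ∈ Y, y ∈ C := by
  classical
  set N := (d + 1) * ((d + 1) * (d + 1)) + 1 with hN
  set η : ℝ := ε ^ N * ((Fintype.card (Fin N → Fin (d + 1)) : ℝ)⁻¹ / (d + 1)) with hη
  have hη0 : 0 < η := by
    have : 0 < Fintype.card (Fin N → Fin (d + 1)) := Fintype.card_pos
    positivity
  obtain ⟨c, hc⟩ := exists_nat_gt (1 / η)
  refine ⟨c, fun {E} _ _ _ hd {ι} _ {w} hw x => ?_⟩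
  have hW := powWeight_mem_stdSimplex (κ := Fin N) hw
  -- Greedy choice: while `Y` is not a net, one more point meets the hulls of a fixed proportion of
  -- tuples whose hulls were not met before.
  have key : ∀ n : ℕ, ∃ Y : Finset E, Y.card ≤ n ∧
      ((∀ C : Set E, Convex ℝ C → (ε ≤ mass w fun i => x i ∈ C) → ∃ y ∈ Y, y ∈ C) ∨
      n * η ≤ mass (powWeight (Fin N) w)
        fun t => ∃ y ∈ Y, y ∈ convexHull ℝ (Set.range (x ∘ t))) := by
    intro n
    induction n with
    | zero => exact ⟨∅, by simp, Or.inr (by simpa using mass_nonneg hW.1 _)⟩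
    | succ n ih =>
      obtain ⟨Y, hY, h | h⟩ := ih
      · exact ⟨Y, hY.trans n.le_succ, Or.inl h⟩
      by_cases hnet : ∀ C : Set E, Convex ℝ C → (ε ≤ mass w fun i => x i ∈ C) → ∃ y ∈ Y, y ∈ C
      · exact ⟨Y, hY.trans n.le_succ, Or.inl hnet⟩
      push Not at hnet
      obtain ⟨C, hC, hCε, hCY⟩ := hnet
      obtain ⟨z, hz⟩ := exists_le_mass_mem_convexHull_of_le_mass hd (Nat.lt_succ_self _) hw x hε hCε
      refine ⟨insert z Y, (Finset.card_insert_le _ _).trans (by omega), Or.inr ?_⟩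
      calc ((n + 1 : ℕ) : ℝ) * η = n * η + η := by push_cast; ring
        _ ≤ _ := add_le_add h hz
        _ ≤ _ := by
          refine mass_add_le hW.1 ?_ ?_ ?_
          · rintro t ⟨y, hy, hyt⟩ ⟨htC, -⟩
            refine hCY y hy (convexHull_min ?_ hC hyt)
            rintro _ ⟨k, rfl⟩
            exact htC k
          · rintro t ⟨y, hy, hyt⟩
            exact ⟨y, Finset.mem_insert_of_mem hy, hyt⟩
          · rintro t ⟨-, hzt⟩
            exact ⟨z, Finset.mem_insert_self _ _, hzt⟩
  obtain ⟨Y, hY, h | h⟩ := key c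
  · exact ⟨Y, hY, h⟩
  · have h1 := h.trans (mass_le_one hW _)
    rw [div_lt_iff₀ hη0] at hc
    linarith

end WeakNet

/-! ### Duality -/

/-- Linear programming duality for a finite set system: if for every weight on the sets some point
lies in sets of weight at least `β`, then some finitely supported weight on the points gives each
set weight at least `β`. -/
theorem exists_weight_of_forall_weight {X : Type*} [Nonempty X] {ι : Type*} [Fintype ι]
    (A : ι → Set X) {β : ℝ} (h : ∀ w ∈ stdSimplex ℝ ι, ∃ x, β ≤ mass w fun i => x ∈ A i) :
    ∃ (κ : Type) (_ : Fintype κ) (u : κ → ℝ) (x : κ → X), u ∈ stdSimplex ℝ κ ∧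
      ∀ i, β ≤ mass u fun k => x k ∈ A i := by
  classical
  let φ : X → ι → ℝ := fun x i => if x ∈ A i then 1 else 0
  have hfin : (Set.range φ).Finite := by
    refine (Set.Finite.pi' (t := fun _ : ι => ({0, 1} : Set ℝ)) fun _ => by simp).subset ?_
    rintro _ ⟨x, rfl⟩ i
    simp only [φ]
    split_ifs <;> simp
  let D : Set (ι → ℝ) := Set.Ici fun _ => β
  by_cases hdis : Disjoint (convexHull ℝ (Set.range φ)) D
  · exfalso
    obtain ⟨f, a, b, hfa, hab, hfb⟩ := geometric_hahn_banach_compact_closed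
      (convex_convexHull ℝ _) (hfin.isCompact_convexHull (𝕜 := ℝ)) (convex_Ici (𝕜 := ℝ) _)
      isClosed_Ici hdis
    let g : ι → ℝ := fun i => f (Pi.single i 1)
    have hf : ∀ v, f v = ∑ i, g i * v i := by
      intro v
      conv_lhs => rw [← Finset.univ_sum_single v, map_sum]
      refine Finset.sum_congr rfl fun i _ => ?_
      have : Pi.single i (v i) = v i • (Pi.single i (1 : ℝ) : ι → ℝ) := by
        rw [← Pi.single_smul]; simp
      rw [this, map_smul, smul_eq_mul, mul_comm]
    have hfφ : ∀ x, f (φ x) = mass g fun i => x ∈ A i := by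
      intro x
      rw [hf, mass]
      exact Finset.sum_congr rfl fun i _ => by simp [φ]
    have hg : ∀ i, 0 ≤ g i := by
      intro i
      by_contra! hi
      -- Along a coordinate with negative coefficient `f` is unbounded below on `D`.
      obtain ⟨n, hn⟩ := exists_nat_gt ((f (fun _ => β) - b) / -g i)
      have h1 : b < f ((fun _ => β) + (n : ℝ) • Pi.single i 1) := by
        refine hfb _ (Set.mem_Ici.2 (le_add_of_nonneg_right ?_))
        exact smul_nonneg n.cast_nonneg (Pi.single_nonneg.2 zero_le_one)
      rw [map_add, map_smul, smul_eq_mul] at h1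
      rw [div_lt_iff₀ (by linarith)] at hn
      change _ < _ + (n : ℝ) * g i at h1
      linarith
    have hb : b < β * ∑ i, g i := by
      have := hfb (fun _ => β) (Set.mem_Ici.2 le_rfl)
      rwa [hf, ← Finset.sum_mul, mul_comm] at this
    have hφa : ∀ x, mass g (fun i => x ∈ A i) < a := fun x => by
      rw [← hfφ]
      exact hfa _ (subset_convexHull ℝ _ ⟨x, rfl⟩)
    have hs : 0 < ∑ i, g i := by
      refine (Finset.sum_nonneg fun i _ => hg i).lt_of_ne fun h0 => ?_
      rw [← h0, mul_zero] at hb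
      obtain ⟨x⟩ := ‹Nonempty X›
      have := mass_nonneg hg fun i => x ∈ A i
      linarith [hφa x]
    obtain ⟨x, hx⟩ := h (fun i => (∑ i, g i)⁻¹ * g i)
      ⟨fun i => mul_nonneg (inv_nonneg.2 hs.le) (hg i), by
        rw [← Finset.mul_sum, inv_mul_cancel₀ hs.ne']⟩
    have hx' : mass (fun i => (∑ i, g i)⁻¹ * g i) (fun i => x ∈ A i) =
        (∑ i, g i)⁻¹ * mass g fun i => x ∈ A i := by
      unfold mass
      rw [Finset.mul_sum]
      exact Finset.sum_congr rfl fun i _ => by split_ifs <;> simp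
    rw [hx', ← div_eq_inv_mul, le_div_iff₀ hs] at hx
    linarith [hφa x]
  · rw [Set.not_disjoint_iff] at hdis
    obtain ⟨v, hv, hvD⟩ := hdis
    obtain ⟨κ, hκ, u, y, hu0, hu1, hy, rfl⟩ := mem_convexHull_iff_exists_fintype.1 hv
    choose x hx using hy
    refine ⟨κ, hκ, u, x, ⟨hu0, hu1⟩, fun i => ?_⟩
    have := hvD i
    simp only [Finset.sum_apply, Pi.smul_apply, smul_eq_mul, ← hx, φ, mul_ite, mul_one,
      mul_zero] at this
    unfold mass
    exact this

/-! ### Piercing -/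

section Piercing

open Module

variable {E : Type*} [NormedAddCommGroup E] [InnerProductSpace ℝ E] [FiniteDimensional ℝ E]

/-- In a family of nonempty sets with the `(p, q)` property, `q ≥ d + 1`, among any `d * p + 1`
members, repetitions allowed, some `d + 1` have a point in common. -/
lemma HasPQProperty.exists_embedding {X : Type*} {p q d : ℕ} {F : Set (Set X)}
    (hF : HasPQProperty p q F) (hdq : d + 1 ≤ q) (hne : ∀ A ∈ F, A.Nonempty)
    (t : Fin (d * p + 1) → F) :
    ∃ e : Fin (d + 1) ↪ Fin (d * p + 1), (⋂ j, (t (e j) : Set X)).Nonempty := by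
  classical
  suffices ∃ J : Finset (Fin (d * p + 1)), d + 1 ≤ J.card ∧ (⋂ j ∈ J, (t j : Set X)).Nonempty by
    obtain ⟨J, hJ, z, hz⟩ := this
    obtain ⟨e⟩ : Nonempty (Fin (d + 1) ↪ J) :=
      Function.Embedding.nonempty_of_card_le (by simpa using hJ)
    refine ⟨e.trans (Function.Embedding.subtype _), z, Set.mem_iInter.2 fun j => ?_⟩
    exact Set.mem_iInter₂.1 hz _ (e j).2
  let R : Finset (Set X) := Finset.univ.image fun k => (t k : Set X)
  by_cases hR : p ≤ R.card
  · -- There are `p` distinct members among the `t k`.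
    obtain ⟨S, hSR, hS⟩ := Finset.exists_subset_card_eq hR
    obtain ⟨T, hTS, hT, z, hz⟩ := hF S (fun A hA => by
      obtain ⟨k, -, rfl⟩ := Finset.mem_image.1 (hSR hA)
      exact (t k).2) hS
    refine ⟨Finset.univ.filter fun k => (t k : Set X) ∈ T, ?_, z, ?_⟩
    · refine (hdq.trans hT.ge).trans (le_trans (Finset.card_le_card ?_)
        (Finset.card_image_le (f := fun k => (t k : Set X))))
      intro A hA
      obtain ⟨k, -, rfl⟩ := Finset.mem_image.1 (hSR (hTS hA))
      exact Finset.mem_image.2 ⟨k, by simpa using hA, rfl⟩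
    · simp only [Finset.mem_filter, Finset.mem_univ, true_and, Set.mem_iInter]
      exact fun k hk => hz _ hk
  · -- Otherwise some member is repeated `d + 1` times.
    obtain ⟨A, hA, hlt⟩ := Finset.exists_lt_card_fiber_of_mul_lt_card_of_maps_to
      (s := (Finset.univ : Finset (Fin (d * p + 1)))) (t := R) (n := d)
      (f := fun k => (t k : Set X)) (fun k hk => Finset.mem_image_of_mem _ hk)
      (by
        rw [Finset.card_univ, Fintype.card_fin, mul_comm]
        exact Nat.lt_succ_of_le (Nat.mul_le_mul_left _ (by omega)))
    obtain ⟨k, -, rfl⟩ := Finset.mem_image.1 hA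
    obtain ⟨z, hz⟩ := hne _ (t k).2
    refine ⟨_, hlt, z, ?_⟩
    simp only [Finset.mem_filter, Finset.mem_univ, true_and, Set.mem_iInter]
    intro j hj
    rwa [hj]

lemma HasPQProperty.mono {X : Type*} {p q : ℕ} {F G : Set (Set X)} (hF : HasPQProperty p q F)
    (hGF : G ⊆ F) : HasPQProperty p q G :=
  fun S hS => hF S (hS.trans hGF)

/-- The bound for finite families. -/
theorem exists_piercing_finset_of_finite (p q d : ℕ) (hdq : d + 1 ≤ q) : ∃ c : ℕ,
    ∀ {E : Type*} [NormedAddCommGroup E] [InnerProductSpace ℝ E] [FiniteDimensional ℝ E],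
    finrank ℝ E = d → ∀ F : Finset (Set E),
    (∀ A ∈ F, A.Nonempty ∧ IsCompact A ∧ Convex ℝ A) → HasPQProperty p q (F : Set (Set E)) →
    ∃ Y : Finset E, Y.card ≤ c ∧ ∀ A ∈ F, ∃ y ∈ Y, y ∈ A := by
  classical
  set α : ℝ := (Fintype.card (Fin (d + 1) ↪ Fin (d * p + 1)) : ℝ)⁻¹ with hα
  by_cases hp : Nonempty (Fin (d + 1) ↪ Fin (d * p + 1))
  swap
  · -- By `HasPQProperty.exists_embedding` a nonempty family would provide an embedding.
    refine ⟨0, fun {E} _ _ _ _ F hF hpq => ⟨∅, by simp, fun A hA => ?_⟩⟩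
    obtain ⟨e, -⟩ := hpq.exists_embedding hdq (fun A hA => (hF A hA).1) fun _ => ⟨A, hA⟩
    exact absurd ⟨e⟩ hp
  have hα0 : 0 < α := inv_pos.2 (Nat.cast_pos.2 Fintype.card_pos)
  have hβ : 0 < α / (d + 1) := by positivity
  obtain ⟨c, hc⟩ := exists_weak_net d hβ
  refine ⟨c, fun {E} _ _ _ hd F hF hpq => ?_⟩
  obtain ⟨κ, _, u, x, hu, hux⟩ := exists_weight_of_forall_weight (β := α / (d + 1))
    (fun A : (F : Set (Set E)) => (A : Set E)) fun w hw => by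
      refine fractional_helly hd hw (fun A => (hF A A.2).2.2)
        (fun A => (hF A A.2).2.1.isClosed) ?_
      obtain ⟨e, he⟩ := exists_inv_card_le_mass
        (powWeight_mem_stdSimplex (κ := Fin (d * p + 1)) hw)
        (P := fun (e : Fin (d + 1) ↪ Fin (d * p + 1)) t => (⋂ j, (t (e j) : Set E)).Nonempty)
        (hpq.exists_embedding hdq fun A hA => (hF A hA).1)
      rw [← mass_powWeight_comp hw e.injective]
      exact he
  obtain ⟨Y, hY, hYC⟩ := hc hd hu x
  exact ⟨Y, hY, fun A hA => hYC A (hF A hA).2.2 (hux ⟨A, hA⟩)⟩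

/-- Compactness: a family of compact convex sets whose finite subfamilies are pierced by `c` points
each is pierced by `c` points. -/
theorem exists_piercing_finset_of_forall_finite {F : Set (Set E)} {c : ℕ}
    (hF : ∀ A ∈ F, A.Nonempty ∧ IsCompact A ∧ Convex ℝ A)
    (h : ∀ G : Finset (Set E), (G : Set (Set E)) ⊆ F →
      ∃ Y : Finset E, Y.card ≤ c ∧ ∀ A ∈ G, ∃ y ∈ Y, y ∈ A) :
    ∃ Y : Finset E, Y.card ≤ c ∧ ∀ A ∈ F, ∃ y ∈ Y, y ∈ A := by
  classical
  rcases F.eq_empty_or_nonempty with rfl | ⟨A₀, hA₀⟩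
  · exact ⟨∅, by simp, by simp⟩
  have : Nonempty (Fin c) := by
    obtain ⟨Y, hY, hYA⟩ := h {A₀} (by simpa using hA₀)
    obtain ⟨y, hy, -⟩ := hYA A₀ (Finset.mem_singleton_self _)
    exact ⟨⟨0, (Finset.card_pos.2 ⟨y, hy⟩).trans_le hY⟩⟩
  have h' : ∀ G : Finset F, ∃ g : F → Fin c, ∃ y : Fin c → E, ∀ A ∈ G, y (g A) ∈ (A : Set E) := by
    intro G
    obtain ⟨Y, hY, hYG⟩ := h (G.image Subtype.val) (by simp)
    obtain ⟨e⟩ : Nonempty (Y ↪ Fin c) := Function.Embedding.nonempty_of_card_le (by simpa using hY)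
    have hex : ∀ A ∈ G, ∃ i, Function.extend e Subtype.val (fun _ => 0) i ∈ (A : Set E) := by
      intro A hA
      obtain ⟨y, hy, hyA⟩ := hYG A (Finset.mem_image_of_mem _ hA)
      exact ⟨e ⟨y, hy⟩, by rwa [e.injective.extend_apply]⟩
    choose! g hg using hex
    exact ⟨g, _, hg⟩
  choose g y hy using h'
  -- Rado's selection principle assembles the assignments of members to piercing points.
  obtain ⟨χ, hχ⟩ := Finset.rado_selection g
  have hpt : ∀ i : Fin c, ∃ z, ∀ A : F, χ A = i → z ∈ (A : Set E) := by
    intro i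
    have := Convex.helly_theorem_compact' (𝕜 := ℝ)
      (F := fun A : {A : F // χ A = i} => ((A : F) : Set E))
      (fun A => (hF _ A.1.2).2.2) (fun A => (hF _ A.1.2).2.1) ?_
    · obtain ⟨z, hz⟩ := this
      exact ⟨z, fun A hA => Set.mem_iInter.1 hz ⟨A, hA⟩⟩
    · intro I _
      obtain ⟨t, hIt, ht⟩ := hχ (I.image Subtype.val)
      refine ⟨y t i, Set.mem_iInter₂.2 fun A hA => ?_⟩
      have hA' : (A : F) ∈ I.image Subtype.val := Finset.mem_image_of_mem _ hA
      have := hy t A (hIt hA')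
      rwa [← ht _ hA', A.2] at this
  choose z hz using hpt
  refine ⟨Finset.univ.image z, Finset.card_image_le.trans (by simp), fun A hA => ?_⟩
  exact ⟨z (χ ⟨A, hA⟩), by simp, hz _ ⟨A, hA⟩ rfl⟩

/-- A finite set of points meeting all members of a family splits it into intersecting
subfamilies. -/
lemma piercingNumber_le_card {X : Type*} {F : Set (Set X)} (Y : Finset X)
    (hY : ∀ A ∈ F, ∃ y ∈ Y, y ∈ A) : piercingNumber F ≤ Y.card := by
  classical
  choose f hfY hfA using hY
  refine iInf₂_le Y.card ⟨Y.image (fun y => {A | ∃ hA : A ∈ F, f A hA = y}),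
    Finset.card_image_le, ?_, ?_, ?_⟩
  · intro G hG H hH hGH
    obtain ⟨y, -, rfl⟩ := Finset.mem_image.1 hG
    obtain ⟨y', -, rfl⟩ := Finset.mem_image.1 hH
    refine Set.disjoint_left.2 ?_
    rintro A ⟨_, rfl⟩ ⟨_, rfl⟩
    exact hGH rfl
  · ext A
    simp only [Set.mem_sUnion, Finset.coe_image, Set.mem_image, Finset.mem_coe]
    constructor
    · rintro ⟨_, ⟨y, -, rfl⟩, hA, -⟩
      exact hA
    · exact fun hA => ⟨_, ⟨f A hA, hfY A hA, rfl⟩, hA, rfl⟩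
  · intro G hG
    obtain ⟨y, -, rfl⟩ := Finset.mem_image.1 hG
    refine ⟨y, ?_⟩
    rintro A ⟨hA, rfl⟩
    exact hfA A hA

end Piercing

theorem theorem1p1 (p q d : ℕ) (hdq : d + 1 ≤ q) (hqp : q ≤ p) :
    ∃ c : ℕ, maxPiercingNumber p q d ≤ (c : ℕ∞) ∧
      ∀ F : Set (Set (EuclideanSpace ℝ (Fin d))),
        IsCompactConvexFamily F → HasPQProperty p q F →
          ∃ X : Finset (EuclideanSpace ℝ (Fin d)), X.card ≤ c ∧
            ∀ A ∈ F, ((X : Set (EuclideanSpace ℝ (Fin d))) ∩ A).Nonempty := by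
  obtain ⟨c, hc⟩ := exists_piercing_finset_of_finite p q d hdq
  have main : ∀ F : Set (Set (EuclideanSpace ℝ (Fin d))), IsCompactConvexFamily F →
      HasPQProperty p q F →
      ∃ Y : Finset (EuclideanSpace ℝ (Fin d)), Y.card ≤ c ∧ ∀ A ∈ F, ∃ y ∈ Y, y ∈ A :=
    fun F hF hpq => exists_piercing_finset_of_forall_finite hF fun G hG =>
      hc (by simp) G (fun A hA => hF A (hG hA)) (hpq.mono hG)
  refine ⟨c, ?_, fun F hF hpq => ?_⟩
  · refine iSup_le fun F => iSup₂_le fun hF hpq => ?_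
    obtain ⟨Y, hY, hYF⟩ := main F hF hpq
    exact (piercingNumber_le_card Y hYF).trans (Nat.cast_le.2 hY)
  · obtain ⟨Y, hY, hYF⟩ := main F hF hpq
    exact ⟨Y, hY, fun A hA => (hYF A hA).imp fun y hy => ⟨hy.1, hy.2⟩⟩
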